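/- **Setting.** Let $G$ be a group with a finite symmetric set of generators $S$ (that is, $s\in S$ implies $s^{-1}\in S$), and let $U$ be an arbitrary group. Let $X$ be a non-empty set with a free left $G$-action and a commuting free right $U$-action, and let $X_1\subset X_2\subset\cdots\subset X$ be a sequence of $U$-invariant subsets with $\bigcup_k X_k=X$, with $N_k:=|X_k/U|<\infty$ for every $k$, and with $$\frac{|(S\cdot X_k\setminus X_k)/U|}{|X_k/U|}\longrightarrow 0\qquad (k\to\infty),$$ where $A/U$ denotes the set of $U$-orbits in an invariant subset $A\subset X$. (Thus $G$ is a generalized amenable extension of $U$, with Følner exhaustion $(X_k)$ of the $G$-$U$-set $X$. Since $X\neq\emptyset$, $N_k>0$ for all large $k$.) Let $d\in\mathbb{N}$ and $B=(B_{kl})\in M(d\times d,\mathbb{C}G)$. Then $B$ induces the bounded operator $B_X$ on $l^2(X)^d$ given by $$(B_Xf)_k(x)=\sum_{l=1}^d\sum_{g\in G}(B_{kl})_g\, f_l(g^{-1}x),$$ and, for $X=G$ with left multiplication, the operator $B$ on $l^2(G)^d$ (left convolution). Let $P_i\colon l^2(X)^d\to l^2(X_i)^d$ be the orthogonal projection (restriction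 of functions to $X_i$), so that $P_i^*$ is extension by zero, and set $B[i]:=P_iB_XP_i^*$, a bounded operator on $l^2(X_i)^d$. For a closed right $G$-invariant subspace $V\subset l^2(G)^d$ put $\dim_G V:=\sum_{j=1}^d\langle \mathrm{pr}_V e_j,e_j\rangle$, where $\mathrm{pr}_V$ is the orthogonal projection onto $V$ and $e_j$ is the unit element of $G$ in position $j$. For a closed right $U$-invariant subspace $V\subset l^2(X_i)^d$ put $\dim_U V:=\sum_{x}\sum_{j=1}^d\langle \mathrm{pr}_V(x\otimes e_j),x\otimes e_j\rangle$, where $x$ runs through a set of representatives of $X_i/U$ (the value does not depend on the choice). **Theorem.** In this situation, for every $d$ and every $B\in M(d\times d,\mathbb{C}G)$, $$\dim_G(\ker B)=\lim_{i\to\infty}\frac{\dim_U\ker(B[i])}{N_i}=\lim_{i\to\infty}\frac{\dim_U\ker\bigl(P_iB_XP_i^*\bigr)}{|X_i/U|}.$$ In particular the limit exists. -/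

import Mathlib

open Filter Topology MulOpposite
open scoped lp Pointwise

noncomputable section

namespace L2Approx

/-! ### Pull-back of square-summable functions along an injective map -/

theorem memlp_comp {α β : Type*} (φ : α → β) (hφ : Function.Injective φ) (f : ℓ²(β, ℂ)) :
    Memℓp (fun a => f (φ a)) 2 := by
  apply memℓp_gen
  have h := (lp.memℓp f).summable (by norm_num)
  exact h.comp_injective hφ

/-- For an injective map `φ : α → β`, the linear map `ℓ²(β) → ℓ²(α)`, `f ↦ f ∘ φ`. -/
def pullbackLin {α β : Type*} (φ : α → β) (hφ : Function.Injective φ) :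
    ℓ²(β, ℂ) →ₗ[ℂ] ℓ²(α, ℂ) where
  toFun f := ⟨fun a => f (φ a), memlp_comp φ hφ f⟩
  map_add' f g := by ext a; rfl
  map_smul' c f := by ext a; rfl

theorem norm_pullbackLin_le {α β : Type*} (φ : α → β) (hφ : Function.Injective φ)
    (f : ℓ²(β, ℂ)) : ‖pullbackLin φ hφ f‖ ≤ 1 * ‖f‖ := by
  have h2 : (0 : ℝ) < (2 : ENNReal).toReal := by norm_num
  have hs := (lp.memℓp f).summable h2
  rw [one_mul]
  refine lp.norm_le_of_tsum_le h2 (norm_nonneg f) ?_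
  rw [lp.norm_rpow_eq_tsum h2 f]
  exact tsum_comp_le_tsum_of_inj hs (fun b => by positivity) hφ

/-- For an injective map `φ : α → β`, the bounded operator `ℓ²(β) → ℓ²(α)`, `f ↦ f ∘ φ`. -/
def pullback {α β : Type*} (φ : α → β) (hφ : Function.Injective φ) :
    ℓ²(β, ℂ) →L[ℂ] ℓ²(α, ℂ) :=
  (pullbackLin φ hφ).mkContinuous 1 (norm_pullbackLin_le φ hφ)

@[simp] theorem pullback_apply {α β : Type*} (φ : α → β) (hφ : Function.Injective φ)
    (f : ℓ²(β, ℂ)) (a : α) : pullback φ hφ f a = f (φ a) := rfl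

/-! ### Operators attached to matrices over the group ring

`l²(X)^d` is the Hilbert space `ℓ²(Fin d × X, ℂ)`. -/

/-- The `k`-th coordinate `l²(X)^d → l²(X)`. -/
def coord {d : ℕ} (X : Type*) (k : Fin d) : ℓ²(Fin d × X, ℂ) →L[ℂ] ℓ²(X, ℂ) :=
  pullback (fun x => (k, x)) (Prod.mk_right_injective k)

/-- Left translation by `g`: `f ↦ (x ↦ f (g⁻¹ x))`; it sends `δ_x` to `δ_{g x}`. -/
def translate {G : Type*} [Group G] (X : Type*) [MulAction G X] (g : G) :
    ℓ²(X, ℂ) →L[ℂ] ℓ²(X, ℂ) :=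
  pullback (fun x => g⁻¹ • x) (MulAction.injective g⁻¹)

/-- The operator on `l²(X)` induced by `b = ∑ b_g g ∈ ℂG`, that is `∑_g b_g • translate g`. For
`X = G` this is left convolution with `b`. -/
def ringOp {G : Type*} [Group G] (X : Type*) [MulAction G X] (b : MonoidAlgebra ℂ G) :
    ℓ²(X, ℂ) →L[ℂ] ℓ²(X, ℂ) :=
  b.coeff.sum fun g c => c • translate X g

/-- The operator `B_X` on `l²(X)^d` induced by a matrix `B` over `ℂG` and an action of `G` on `X`
(the adjoint of `coord X k` is the inclusion of the `k`-th summand). -/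
def matrixOp {G : Type*} [Group G] (X : Type*) [MulAction G X] {d : ℕ}
    (B : Matrix (Fin d) (Fin d) (MonoidAlgebra ℂ G)) :
    ℓ²(Fin d × X, ℂ) →L[ℂ] ℓ²(Fin d × X, ℂ) :=
  ∑ k, ∑ l, (coord X k).adjoint ∘L ringOp X (B k l) ∘L coord X l

theorem ringOp_apply {G : Type*} [Group G] (X : Type*) [MulAction G X] (b : MonoidAlgebra ℂ G)
    (f : ℓ²(X, ℂ)) (x : X) : ringOp X b f x = b.coeff.sum fun g c => c * f (g⁻¹ • x) := by
  simp only [ringOp, Finsupp.sum, _root_.sum_apply, lp.coeFn_sum, Finset.sum_apply]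
  rfl

theorem adjoint_coord_apply {d : ℕ} (X : Type*) (k : Fin d) (f : ℓ²(X, ℂ)) (p : Fin d × X) :
    (coord X k).adjoint f p = if p.1 = k then f p.2 else 0 := by
  classical
  have h1 : inner ℂ (lp.single 2 p (1 : ℂ)) ((coord X k).adjoint f)
      = (coord X k).adjoint f p := by
    rw [lp.inner_single_left]; simp
  rw [← h1, ContinuousLinearMap.adjoint_inner_right]
  obtain ⟨i, x⟩ := p
  by_cases h : i = k
  · subst h
    have : coord X i (lp.single 2 (i, x) (1 : ℂ)) = lp.single 2 x (1 : ℂ) := by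
      ext y
      simp [coord, Pi.single_apply]
    rw [this, lp.inner_single_left]; simp
  · have : coord X k (lp.single 2 (i, x) (1 : ℂ)) = 0 := by
      ext y
      simp [coord, Ne.symm h]
    simp [this, h]

/-- The explicit formula `(B_X f)_k (x) = ∑_l ∑_g (B_{kl})_g f_l (g⁻¹ x)`. -/
theorem matrixOp_apply {G : Type*} [Group G] (X : Type*) [MulAction G X] {d : ℕ}
    (B : Matrix (Fin d) (Fin d) (MonoidAlgebra ℂ G)) (f : ℓ²(Fin d × X, ℂ))
    (k : Fin d) (x : X) :
    matrixOp X B f (k, x) = ∑ l, (B k l).coeff.sum fun g c => c * f (l, g⁻¹ • x) := by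
  simp only [matrixOp, _root_.sum_apply, lp.coeFn_sum, Finset.sum_apply,
    ContinuousLinearMap.comp_apply, adjoint_coord_apply, ringOp_apply]
  rw [Finset.sum_eq_single k]
  · simp [coord]
  · intro b _ hb
    simp [Ne.symm hb]
  · simp

/-- The orthogonal projection `P : l²(X)^d → l²(Y)^d` for a `U`-invariant subset `Y ⊆ X`, i.e.
restriction of functions to `Y`; its adjoint `P^*` is extension by zero. -/
def restrict {U X : Type*} [Group U] [MulAction Uᵐᵒᵖ X] (d : ℕ) (Y : SubMulAction Uᵐᵒᵖ X) :
    ℓ²(Fin d × X, ℂ) →L[ℂ] ℓ²(Fin d × Y, ℂ) :=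
  pullback (Prod.map id Subtype.val) (Function.injective_id.prodMap Subtype.val_injective)

/-- The compression `P B_X P^*` of `B_X` to `l²(Y)^d`, for a `U`-invariant subset `Y ⊆ X`. -/
def compression {G U X : Type*} [Group G] [Group U] [MulAction G X] [MulAction Uᵐᵒᵖ X] {d : ℕ}
    (B : Matrix (Fin d) (Fin d) (MonoidAlgebra ℂ G)) (Y : SubMulAction Uᵐᵒᵖ X) :
    ℓ²(Fin d × Y, ℂ) →L[ℂ] ℓ²(Fin d × Y, ℂ) :=
  restrict d Y ∘L matrixOp X B ∘L (restrict d Y).adjoint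

/-! ### Von Neumann dimensions -/

/-- `∑_j ⟨pr_V (y ⊗ e_j), y ⊗ e_j⟩`, where `pr_V` is the orthogonal projection onto `V`. -/
def localDim {Y : Type*} {d : ℕ} (V : Submodule ℂ ℓ²(Fin d × Y, ℂ))
    [V.HasOrthogonalProjection] (y : Y) : ℝ :=
  open Classical in
  ∑ j : Fin d, (inner ℂ (V.starProjection (lp.single 2 (j, y) 1))
    (lp.single 2 (j, y) (1 : ℂ))).re

/-- The von Neumann dimension `dim_G V` of a closed right `G`-invariant subspace `V` of `l²(G)^d`:
the trace `∑_j ⟨pr_V e_j, e_j⟩` with `e_j` the unit of `G` in position `j`. -/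
def groupDim {G : Type*} [Group G] {d : ℕ} (V : Submodule ℂ ℓ²(Fin d × G, ℂ))
    [V.HasOrthogonalProjection] : ℝ :=
  localDim V (1 : G)

/-- The set `Y/U` of orbits of a right action of `U` on `Y` (an action of `Uᵐᵒᵖ`). -/
abbrev Orbits (U Y : Type*) [Group U] [MulAction Uᵐᵒᵖ Y] : Type _ :=
  MulAction.orbitRel.Quotient Uᵐᵒᵖ Y

/-- The von Neumann dimension `dim_U V` of a closed right `U`-invariant subspace `V` of `l²(Y)^d`,
where `Y` is a free right `U`-set with finitely many orbits. A choice of one point in each orbit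
identifies `l²(Y)^d` with a direct sum of `|Y/U|` copies of `l²(U)^d`, and `dim_U V` is the sum of
the diagonal coefficients of `pr_V` at the chosen points. -/
def vnDim (U : Type*) {Y : Type*} [Group U] [MulAction Uᵐᵒᵖ Y] [Finite (Orbits U Y)] {d : ℕ}
    (V : Submodule ℂ ℓ²(Fin d × Y, ℂ)) [V.HasOrthogonalProjection] : ℝ :=
  ∑ᶠ ω : Orbits U Y, localDim V (Quotient.out ω)

/-- Right translation on `l²(Y)^d` by an element of `U`. -/
def rightTranslate {U : Type*} (Y : Type*) [Group U] [MulAction Uᵐᵒᵖ Y] (d : ℕ) (u : Uᵐᵒᵖ) :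
    ℓ²(Fin d × Y, ℂ) →L[ℂ] ℓ²(Fin d × Y, ℂ) :=
  pullback (Prod.map id (u • ·)) (Function.injective_id.prodMap (MulAction.injective u))

theorem inner_rightTranslate {U Y : Type*} [Group U] [MulAction Uᵐᵒᵖ Y] {d : ℕ} (u : Uᵐᵒᵖ)
    (f g : ℓ²(Fin d × Y, ℂ)) :
    inner ℂ (rightTranslate Y d u f) g = inner ℂ f (rightTranslate Y d u⁻¹ g) := by
  rw [lp.inner_eq_tsum, lp.inner_eq_tsum]
  rw [← ((Equiv.refl (Fin d)).prodCongr (MulAction.toPerm u⁻¹)).tsum_eq]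
  refine tsum_congr fun p => ?_
  obtain ⟨i, y⟩ := p
  simp [rightTranslate]

/-- `dim_U V` does not depend on the chosen points: if `V` is invariant under right translation by
`U`, then `localDim V` is constant on orbits. -/
theorem localDim_smul {U Y : Type*} [Group U] [MulAction Uᵐᵒᵖ Y] {d : ℕ}
    (V : Submodule ℂ ℓ²(Fin d × Y, ℂ)) [V.HasOrthogonalProjection]
    (hV : ∀ (u : Uᵐᵒᵖ), ∀ f ∈ V, rightTranslate Y d u f ∈ V)
    (u : Uᵐᵒᵖ) (y : Y) : localDim V (u • y) = localDim V y := by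
  classical
  have hcomm : ∀ f, rightTranslate Y d u (V.starProjection f)
      = V.starProjection (rightTranslate Y d u f) := by
    intro f
    symm
    apply Submodule.eq_starProjection_of_mem_of_inner_eq_zero (hV u _ (V.starProjection_apply_mem f))
    intro w hw
    rw [← map_sub, inner_rightTranslate]
    exact V.starProjection_inner_eq_zero f _ (hV _ _ hw)
  have hs : ∀ j : Fin d, rightTranslate Y d u (lp.single 2 (j, u • y) (1 : ℂ))
      = lp.single 2 (j, y) (1 : ℂ) := by
    intro j
    ext p
    simp [rightTranslate, Pi.single_apply, Prod.ext_iff]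
  have hs' : ∀ j : Fin d, rightTranslate Y d u⁻¹ (lp.single 2 (j, y) (1 : ℂ))
      = lp.single 2 (j, u • y) (1 : ℂ) := by
    intro j
    ext p
    simp [rightTranslate, Pi.single_apply, Prod.ext_iff, inv_smul_eq_iff]
  unfold localDim
  refine Finset.sum_congr rfl fun j _ => ?_
  have := inner_rightTranslate u (V.starProjection (lp.single 2 (j, u • y) (1 : ℂ)))
    (lp.single 2 (j, y) (1 : ℂ))
  rw [hcomm, hs, hs'] at this
  convert congrArg Complex.re this.symm

/-! ### Generalized amenable extensions -/

/-- The number `|A/U|` of `U`-orbits that meet `A`, for a subset `A` of a right `U`-set (which is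
the number of orbits in `A` when `A` is invariant). -/
def orbitCount (U : Type*) {X : Type*} [Group U] [MulAction Uᵐᵒᵖ X] (A : Set X) : ℕ :=
  ((Quotient.mk _ : X → Orbits U X) '' A).ncard

/-- `X` carries commuting free actions of `G` from the left and of `U` from the right, `S` is a
finite symmetric set of generators of `G`, and `E 0 ⊆ E 1 ⊆ ⋯ ⊆ X` is an exhaustion of `X` by right
`U`-invariant subsets with finitely many orbits which satisfies the Følner condition
`|(S E_k - E_k)/U| / |E_k/U| → 0`. By definition, `G` is a generalized amenable extension of `U` if
there are such data with `X` non-empty. -/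
structure IsFolnerExhaustion (G U : Type*) {X : Type*} [Group G] [Group U] [MulAction G X]
    [MulAction Uᵐᵒᵖ X] (S : Finset G) (E : ℕ → SubMulAction Uᵐᵒᵖ X) : Prop where
  comm : ∀ (g : G) (u : Uᵐᵒᵖ) (x : X), g • u • x = u • g • x
  free_left : ∀ (g : G) (x : X), g • x = x → g = 1
  free_right : ∀ (u : Uᵐᵒᵖ) (x : X), u • x = x → u = 1
  symm : ∀ s ∈ S, s⁻¹ ∈ S
  generates : Subgroup.closure (S : Set G) = ⊤
  mono : Monotone E
  exhausts : ∀ x : X, ∃ k, x ∈ E k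
  finite_orbits : ∀ k, Finite (Orbits U (E k))
  folner : Tendsto (fun k => (orbitCount U (((S : Set G) • (E k : Set X)) \ (E k : Set X)) : ℝ) /
    (Nat.card (Orbits U (E k)) : ℝ)) atTop (𝓝 0)

end L2Approx

end

/-! Let $A_i\subset X_i$ be the set of points that some $g$ in the support of $B$, or its inverse,
moves out of $X_i$. The proof shows $|\dim_U\ker B[i]-N_i\dim_G\ker B|\le d\,|A_i/U|$. The Følner
condition gives $|A_i/U|/N_i\to 0$ (`tendsto_ncard_boundary_div`), so no spectral approximation is
needed.

The kernels of $B[i]$ and $B_X$ agree up to conditions on $A_i$. A vector of $\ker B[i]$ that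
vanishes on $A_i$ lies in $\ker B_X$ after extension by zero. Conversely, for $f\in\ker B_X$, the
image of $f|_{X_i}$ under $B[i]$ vanishes off $A_i$. Since $G$ acts freely, the diagonal
coefficients of the projection onto $\ker B_X$ sum to $\dim_G\ker B$ at every point
(`localDim_ker_matrixOp`). Projections can thus be compared point by point, and no $U$-dimension on
all of $X$ is needed.

A condition on $A$ costs dimension at most $d\,|A/U|$ (`vnDim_le_vnDim_add`). This follows from a
form of rank-nullity, $\dim\ker S=\dim\ker S^*$ (`vnDim_ker_adjoint`). For a contraction $S$, the
mean ergodic theorem recovers the projection onto $\ker S$ as the strong limit of Cesàro means of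
$(1-S^*S)^n$. The trace is cyclic, by mass transport, so it agrees on $(1-S^*S)^n$ and $(1-SS^*)^n$.
-/

noncomputable section

namespace L2Approx

/-! ### Traces of equivariant operators -/

/-- Mass transport: for a free action with finitely many orbits and a function `φ` on pairs that is
invariant under the diagonal action, mass sent equals mass received. -/
theorem finsum_tsum_transport {Γ Y : Type*} [Group Γ] [MulAction Γ Y]
    (free : ∀ (γ : Γ) (y : Y), γ • y = y → γ = 1) [Finite (MulAction.orbitRel.Quotient Γ Y)]
    (φ : Y → Y → ℂ) (hφ : ∀ (γ : Γ) x y, φ (γ • x) (γ • y) = φ x y)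
    (hr : ∀ x, Summable (φ x)) (hc : ∀ y, Summable fun x => φ x y) :
    ∑ᶠ ω : MulAction.orbitRel.Quotient Γ Y, ∑' y, φ (Quotient.out ω) y =
      ∑ᶠ ω : MulAction.orbitRel.Quotient Γ Y, ∑' x, φ x (Quotient.out ω) := by
  classical
  have := Fintype.ofFinite (MulAction.orbitRel.Quotient Γ Y)
  -- Representatives of the orbits identify $Y$ with $Y/\Gamma\times\Gamma$; freeness gives
  -- injectivity.
  let e : MulAction.orbitRel.Quotient Γ Y × Γ ≃ Y :=
    Equiv.ofBijective (fun p => p.2 • Quotient.out p.1) <| by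
      constructor
      · rintro ⟨ω, γ⟩ ⟨ω', γ'⟩ h
        dsimp only at h
        have hω : ω = ω' := by
          rw [← Quotient.out_eq ω, ← Quotient.out_eq ω']
          refine Quotient.sound ((MulAction.orbitRel_apply).2 ⟨γ⁻¹ * γ', ?_⟩)
          simp only [mul_smul, ← h, inv_smul_smul]
        subst hω
        have h1 : (γ'⁻¹ * γ) • Quotient.out ω = Quotient.out ω := by
          rw [mul_smul, h, inv_smul_smul]
        have h2 := free _ _ h1
        rw [inv_mul_eq_one] at h2
        rw [h2]
      · intro y
        obtain ⟨γ, hγ⟩ := (MulAction.orbitRel_apply).1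
          ((MulAction.orbitRel Γ Y).symm (Quotient.mk_out (s := MulAction.orbitRel Γ Y) y))
        exact ⟨(Quotient.mk _ y, γ), hγ⟩
  have split : ∀ ψ : Y → ℂ, Summable ψ →
      ∑' y, ψ y = ∑ ω : MulAction.orbitRel.Quotient Γ Y, ∑' γ : Γ, ψ (γ • Quotient.out ω) := by
    intro ψ hψ
    rw [← e.tsum_eq]
    exact (Summable.tsum_prod ((e.summable_iff).2 hψ)).trans (tsum_fintype _)
  simp only [finsum_eq_sum_of_fintype]
  rw [Finset.sum_congr rfl fun ω _ => split _ (hr _),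
    Finset.sum_congr rfl fun ω _ => split _ (hc _), Finset.sum_comm]
  refine Finset.sum_congr rfl fun ω _ => Finset.sum_congr rfl fun ω' _ => ?_
  -- Replacing $\gamma$ by $\gamma^{-1}$ and translating both arguments by $\gamma$ moves the group
  -- element to the other slot.
  rw [← (Equiv.inv Γ).tsum_eq]
  refine tsum_congr fun γ => ?_
  rw [← hφ γ]
  simp

section Trace

variable {U Y : Type*} [Group U] [MulAction Uᵐᵒᵖ Y] {d : ℕ}

/-- The basis vector of `ℓ²(α)` at a point. -/
def delta {α : Type*} (a : α) : ℓ²(α, ℂ) :=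
  open Classical in lp.single 2 a 1

theorem delta_apply {α : Type*} [DecidableEq α] (a b : α) :
    delta a b = if b = a then 1 else 0 := by
  simp only [delta, lp.coeFn_single, Pi.single_apply]
  congr

theorem delta_eq_single {α : Type*} [DecidableEq α] (a : α) : delta a = lp.single 2 a (1 : ℂ) := by
  rw [delta]
  congr!

theorem inner_delta_left {α : Type*} (a : α) (f : ℓ²(α, ℂ)) : inner ℂ (delta a) f = f a := by
  classical
  rw [delta, lp.inner_single_left]
  simp

/-- Invariance of an operator under right translation. -/
def IsEquivariant (U : Type*) {Y : Type*} [Group U] [MulAction Uᵐᵒᵖ Y] {d : ℕ}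
    (A : ℓ²(Fin d × Y, ℂ) →L[ℂ] ℓ²(Fin d × Y, ℂ)) : Prop :=
  ∀ (u : Uᵐᵒᵖ) (f : ℓ²(Fin d × Y, ℂ)), A (rightTranslate Y d u f) = rightTranslate Y d u (A f)

@[simp] theorem rightTranslate_apply (u : Uᵐᵒᵖ) (f : ℓ²(Fin d × Y, ℂ)) (j : Fin d) (y : Y) :
    rightTranslate Y d u f (j, y) = f (j, u • y) := rfl

theorem rightTranslate_delta (u : Uᵐᵒᵖ) (j : Fin d) (y : Y) :
    rightTranslate Y d u (delta (j, u • y)) = delta (j, y) := by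
  classical
  ext ⟨k, z⟩
  simp [delta_apply]

namespace IsEquivariant

variable {A B : ℓ²(Fin d × Y, ℂ) →L[ℂ] ℓ²(Fin d × Y, ℂ)}

theorem one : IsEquivariant U (1 : ℓ²(Fin d × Y, ℂ) →L[ℂ] ℓ²(Fin d × Y, ℂ)) := fun _ _ => rfl

theorem sub (hA : IsEquivariant U A) (hB : IsEquivariant U B) : IsEquivariant U (A - B) :=
  fun u f => by simp [hA u f, hB u f]

theorem mul (hA : IsEquivariant U A) (hB : IsEquivariant U B) : IsEquivariant U (A * B) :=
  fun u f => by simp [hA u _, hB u f]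

theorem smul (c : ℂ) (hA : IsEquivariant U A) : IsEquivariant U (c • A) :=
  fun u f => by simp [hA u f]

theorem pow (hA : IsEquivariant U A) (n : ℕ) : IsEquivariant U (A ^ n) := by
  induction n with
  | zero => exact one
  | succ n ih => rw [pow_succ]; exact ih.mul hA

theorem adjoint (hA : IsEquivariant U A) : IsEquivariant U A.adjoint := by
  intro u f
  refine ext_inner_right ℂ fun g => ?_
  rw [ContinuousLinearMap.adjoint_inner_left, inner_rightTranslate, inner_rightTranslate,
    ContinuousLinearMap.adjoint_inner_left, hA]

theorem mem_ker (hA : IsEquivariant U A) (u : Uᵐᵒᵖ) (f : ℓ²(Fin d × Y, ℂ)) (hf : f ∈ A.ker) :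
    rightTranslate Y d u f ∈ A.ker := by
  rw [LinearMap.mem_ker] at hf ⊢
  exact (hA u f).trans ((congrArg _ hf).trans (map_zero _))

theorem starProjection {V : Submodule ℂ ℓ²(Fin d × Y, ℂ)} [V.HasOrthogonalProjection]
    (hV : ∀ (u : Uᵐᵒᵖ), ∀ f ∈ V, rightTranslate Y d u f ∈ V) :
    IsEquivariant U V.starProjection := by
  intro u f
  apply Submodule.eq_starProjection_of_mem_of_inner_eq_zero (hV u _ (V.starProjection_apply_mem f))
  intro w hw
  rw [← map_sub, inner_rightTranslate]
  exact V.starProjection_inner_eq_zero f _ (hV _ _ hw)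

theorem apply_delta (hA : IsEquivariant U A) (u : Uᵐᵒᵖ) (j k : Fin d) (x y : Y) :
    A (delta (k, u • y)) (j, u • x) = A (delta (k, y)) (j, x) := by
  rw [← rightTranslate_apply, ← hA, rightTranslate_delta]

end IsEquivariant

/-- This is matrix multiplication. The row of `A` consists of the conjugated coefficients of
$A^*\delta_p$, so the sum is an inner product in $\ell^2$ and converges. -/
theorem hasSum_mul_apply_delta {α : Type*} (A B : ℓ²(α, ℂ) →L[ℂ] ℓ²(α, ℂ)) (p : α) :
    HasSum (fun q => A (delta q) p * B (delta p) q) ((A * B) (delta p) p) := by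
  have h := lp.hasSum_inner (𝕜 := ℂ) (A.adjoint (delta p)) (B (delta p))
  rw [ContinuousLinearMap.adjoint_inner_left, inner_delta_left] at h
  have e : (fun q => A (delta q) p * B (delta p) q) =
      fun q => inner ℂ (A.adjoint (delta p) q) (B (delta p) q) := by
    funext q
    rw [RCLike.inner_apply', ← inner_delta_left q (A.adjoint (delta p)), inner_conj_symm,
      ContinuousLinearMap.adjoint_inner_left, inner_delta_left]
  rw [e]
  exact h

/-- The sum of the diagonal coefficients of an operator on `l²(Y)^d` at a point of `Y`. -/
def localTrace (A : ℓ²(Fin d × Y, ℂ) →L[ℂ] ℓ²(Fin d × Y, ℂ)) (y : Y) : ℂ :=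
  ∑ j, A (delta (j, y)) (j, y)

theorem localDim_eq_re_localTrace (V : Submodule ℂ ℓ²(Fin d × Y, ℂ))
    [V.HasOrthogonalProjection] (y : Y) :
    localDim V y = (localTrace V.starProjection y).re := by
  classical
  rw [localDim, localTrace, Complex.re_sum]
  refine Finset.sum_congr rfl fun j _ => ?_
  rw [← inner_delta_left, ← inner_conj_symm, Complex.conj_re, delta_eq_single]

/-- The trace on equivariant operators. -/
def vnTrace (U : Type*) {Y : Type*} [Group U] [MulAction Uᵐᵒᵖ Y] {d : ℕ}
    (A : ℓ²(Fin d × Y, ℂ) →L[ℂ] ℓ²(Fin d × Y, ℂ)) : ℂ :=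
  ∑ᶠ ω : Orbits U Y, localTrace A (Quotient.out ω)

theorem hasSum_localTrace_mul (A B : ℓ²(Fin d × Y, ℂ) →L[ℂ] ℓ²(Fin d × Y, ℂ)) (x : Y) :
    HasSum (fun y => ∑ j, ∑ k, A (delta (k, y)) (j, x) * B (delta (j, x)) (k, y))
      (localTrace (A * B) x) := by
  refine hasSum_sum fun j _ => ?_
  have h := hasSum_mul_apply_delta A B (j, x)
  rw [← (Equiv.prodComm Y (Fin d)).hasSum_iff] at h
  exact h.prod_fiberwise fun y => hasSum_fintype _

/-- Mass transport applies to the products of matrix entries of `A` and `B`, which are invariant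
under the diagonal action by equivariance. -/
theorem vnTrace_mul_comm [Finite (Orbits U Y)]
    (free : ∀ (u : Uᵐᵒᵖ) (y : Y), u • y = y → u = 1)
    {A B : ℓ²(Fin d × Y, ℂ) →L[ℂ] ℓ²(Fin d × Y, ℂ)}
    (hA : IsEquivariant U A) (hB : IsEquivariant U B) :
    vnTrace U (A * B) = vnTrace U (B * A) := by
  have h1 := hasSum_localTrace_mul A B
  have h2 : ∀ y, HasSum (fun x => ∑ j, ∑ k, A (delta (k, y)) (j, x) * B (delta (j, x)) (k, y))
      (localTrace (B * A) y) := by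
    intro y
    convert hasSum_localTrace_mul B A y using 2 with x
    rw [Finset.sum_comm]
    simp only [mul_comm]
  have h := finsum_tsum_transport free
    (fun x y => ∑ j, ∑ k, A (delta (k, y)) (j, x) * B (delta (j, x)) (k, y))
    (fun u x y => by simp only [hA.apply_delta, hB.apply_delta])
    (fun x => (h1 x).summable) (fun y => (h2 y).summable)
  simpa only [(h1 _).tsum_eq, (h2 _).tsum_eq, vnTrace] using h

theorem vnTrace_sub [Finite (Orbits U Y)] (A B : ℓ²(Fin d × Y, ℂ) →L[ℂ] ℓ²(Fin d × Y, ℂ)) :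
    vnTrace U (A - B) = vnTrace U A - vnTrace U B := by
  have := Fintype.ofFinite (Orbits U Y)
  simp [vnTrace, localTrace, finsum_eq_sum_of_fintype]

/-- `tr (1 - S* S)^n = tr (1 - S S*)^n`. -/
theorem vnTrace_pow_one_sub [Finite (Orbits U Y)]
    (free : ∀ (u : Uᵐᵒᵖ) (y : Y), u • y = y → u = 1)
    {S T : ℓ²(Fin d × Y, ℂ) →L[ℂ] ℓ²(Fin d × Y, ℂ)}
    (hS : IsEquivariant U S) (hT : IsEquivariant U T) (n : ℕ) :
    vnTrace U ((1 - T * S) ^ n) = vnTrace U ((1 - S * T) ^ n) := by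
  have hcomm : ∀ n, (1 - T * S) ^ n * T = T * (1 - S * T) ^ n := by
    intro n
    have : SemiconjBy T (1 - S * T) (1 - T * S) := by
      simp only [SemiconjBy, mul_sub, sub_mul, mul_one, one_mul, mul_assoc]
    exact ((this.pow_right n).eq).symm
  induction n with
  | zero => simp
  | succ n ih =>
    -- With $R=(1-ST)^nS$, passing from $n$ to $n+1$ subtracts $TR$ on one side and $RT$ on the
    -- other; these have the same trace.
    have e1 : (1 - T * S) ^ (n + 1) = (1 - T * S) ^ n - T * ((1 - S * T) ^ n * S) := by
      rw [pow_succ, mul_sub, mul_one, ← mul_assoc, hcomm, mul_assoc]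
    have e2 : (1 - S * T) ^ (n + 1) = (1 - S * T) ^ n - ((1 - S * T) ^ n * S) * T := by
      rw [pow_succ, mul_sub, mul_one, ← mul_assoc]
    rw [e1, e2, vnTrace_sub, vnTrace_sub, ih,
      vnTrace_mul_comm free hT ((((IsEquivariant.one).sub (hS.mul hT)).pow n).mul hS)]

end Trace

/-! ### Kernel dimension of an operator and of its adjoint -/

/-- This is the contraction hypothesis of the mean ergodic theorem. It holds since
$\|S^*Sf\|\le\|Sf\|$ in the expansion of $\|f-S^*Sf\|^2$. -/
theorem norm_one_sub_adjoint_mul_self_le {H : Type*} [NormedAddCommGroup H]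
    [InnerProductSpace ℂ H] [CompleteSpace H] (S : H →L[ℂ] H) (hS : ‖S‖ ≤ 1) :
    ‖1 - S.adjoint * S‖ ≤ 1 := by
  refine ContinuousLinearMap.opNorm_le_bound _ zero_le_one fun f => ?_
  rw [one_mul]
  have h1 : ‖f - S.adjoint (S f)‖ ^ 2 = ‖f‖ ^ 2 - 2 * ‖S f‖ ^ 2 + ‖S.adjoint (S f)‖ ^ 2 := by
    rw [@norm_sub_sq ℂ, ContinuousLinearMap.adjoint_inner_right, inner_self_eq_norm_sq]
  have h2 : ‖S.adjoint (S f)‖ ≤ ‖S f‖ := by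
    refine (S.adjoint.le_opNorm _).trans ?_
    rw [LinearIsometryEquiv.norm_map]
    exact mul_le_of_le_one_left (norm_nonneg _) hS
  have h3 : ‖S.adjoint (S f)‖ ^ 2 ≤ ‖S f‖ ^ 2 := by gcongr
  have h4 : ‖f - S.adjoint (S f)‖ ^ 2 ≤ ‖f‖ ^ 2 := by nlinarith [sq_nonneg ‖S f‖]
  exact le_of_sq_le_sq h4 (norm_nonneg _)

theorem mem_ker_adjoint_mul_self {H : Type*} [NormedAddCommGroup H]
    [InnerProductSpace ℂ H] [CompleteSpace H] (S : H →L[ℂ] H) (f : H) :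
    S.adjoint (S f) = 0 ↔ f ∈ S.ker := by
  rw [LinearMap.mem_ker]
  refine ⟨fun h => ?_, fun h => ?_⟩
  · have : inner ℂ (S f) (S f) = 0 := by
      rw [← ContinuousLinearMap.adjoint_inner_left, h, inner_zero_left]
    exact inner_self_eq_zero.1 this
  · have : S f = 0 := h
    rw [this, map_zero]

/-- The Cesàro means of the powers of `1 - S* S` converge strongly to the projection onto the
kernel of `S`. -/
theorem tendsto_cesaro_one_sub_adjoint_mul_self {H : Type*} [NormedAddCommGroup H]
    [InnerProductSpace ℂ H] [CompleteSpace H] (S : H →L[ℂ] H) (hS : ‖S‖ ≤ 1) (f : H) :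
    Tendsto (fun n : ℕ => ((n : ℂ)⁻¹ • ∑ k ∈ Finset.range n, (1 - S.adjoint * S) ^ k) f) atTop
      (𝓝 (S.ker.starProjection f)) := by
  have h := ContinuousLinearMap.tendsto_birkhoffAverage_orthogonalProjection _
    (norm_one_sub_adjoint_mul_self_le S hS) f
  have hk : ((1 - S.adjoint * S).eqLocus (1 : H →L[ℂ] H)) = S.ker := by
    ext g
    rw [← mem_ker_adjoint_mul_self, LinearMap.mem_eqLocus]
    simp
  have e : (((1 - S.adjoint * S).eqLocus (1 : H →L[ℂ] H)).orthogonalProjectionOnto f : H)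
      = S.ker.starProjection f := by
    rw [← Submodule.starProjection_apply]
    congr!
  rw [e] at h
  refine h.congr fun n => ?_
  simp [birkhoffAverage, birkhoffSum]

section Dim

variable {U Y : Type*} [Group U] [MulAction Uᵐᵒᵖ Y] {d : ℕ} [Finite (Orbits U Y)]

theorem vnDim_eq_re_vnTrace (V : Submodule ℂ ℓ²(Fin d × Y, ℂ)) [V.HasOrthogonalProjection] :
    vnDim U V = (vnTrace U V.starProjection).re := by
  have := Fintype.ofFinite (Orbits U Y)
  simp only [vnDim, vnTrace, finsum_eq_sum_of_fintype, Complex.re_sum, localDim_eq_re_localTrace]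

/-- With finitely many orbits the trace is a finite sum of matrix coefficients, so strong
convergence suffices. -/
theorem tendsto_vnTrace {A : ℕ → ℓ²(Fin d × Y, ℂ) →L[ℂ] ℓ²(Fin d × Y, ℂ)}
    {P : ℓ²(Fin d × Y, ℂ) →L[ℂ] ℓ²(Fin d × Y, ℂ)}
    (h : ∀ f, Tendsto (fun n => A n f) atTop (𝓝 (P f))) :
    Tendsto (fun n => vnTrace U (A n)) atTop (𝓝 (vnTrace U P)) := by
  have := Fintype.ofFinite (Orbits U Y)
  simp only [vnTrace, localTrace, finsum_eq_sum_of_fintype, ← inner_delta_left]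
  exact tendsto_finsetSum _ fun ω _ => tendsto_finsetSum _ fun j _ =>
    tendsto_const_nhds.inner (h _)

theorem vnTrace_cesaro (A : ℓ²(Fin d × Y, ℂ) →L[ℂ] ℓ²(Fin d × Y, ℂ)) (n : ℕ) :
    vnTrace U ((n : ℂ)⁻¹ • ∑ k ∈ Finset.range n, A ^ k) =
      (n : ℂ)⁻¹ * ∑ k ∈ Finset.range n, vnTrace U (A ^ k) := by
  have := Fintype.ofFinite (Orbits U Y)
  simp only [vnTrace, localTrace, finsum_eq_sum_of_fintype, _root_.smul_apply,
    _root_.sum_apply, lp.coeFn_smul, lp.coeFn_sum, Finset.sum_apply, Pi.smul_apply, smul_eq_mul,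
    ← Finset.mul_sum]
  congr 1
  simp_rw [Finset.sum_comm (t := Finset.range n)]

theorem vnDim_ker_adjoint_of_norm_le_one (free : ∀ (u : Uᵐᵒᵖ) (y : Y), u • y = y → u = 1)
    {S : ℓ²(Fin d × Y, ℂ) →L[ℂ] ℓ²(Fin d × Y, ℂ)} (hS : IsEquivariant U S) (h1 : ‖S‖ ≤ 1) :
    vnDim U S.ker = vnDim U S.adjoint.ker := by
  have h2 : ‖S.adjoint‖ ≤ 1 := by rwa [LinearIsometryEquiv.norm_map]
  have t1 := tendsto_vnTrace (U := U) (tendsto_cesaro_one_sub_adjoint_mul_self S h1)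
  have t2 := tendsto_vnTrace (U := U) (tendsto_cesaro_one_sub_adjoint_mul_self S.adjoint h2)
  rw [ContinuousLinearMap.adjoint_adjoint] at t2
  simp only [vnTrace_cesaro, ← vnTrace_pow_one_sub free hS hS.adjoint] at t1 t2
  rw [vnDim_eq_re_vnTrace, vnDim_eq_re_vnTrace, tendsto_nhds_unique t1 t2]

theorem ker_smul_eq {H : Type*} [NormedAddCommGroup H] [InnerProductSpace ℂ H] (S : H →L[ℂ] H)
    {c : ℂ} (hc : c ≠ 0) : (c • S).ker = S.ker := by
  ext f
  simp [hc]

theorem vnDim_congr {V W : Submodule ℂ ℓ²(Fin d × Y, ℂ)} [V.HasOrthogonalProjection]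
    [W.HasOrthogonalProjection] (h : V = W) : vnDim U V = vnDim U W := by
  subst h
  rfl

/-- The kernels of an equivariant operator and of its adjoint have equal dimension. -/
theorem vnDim_ker_adjoint (free : ∀ (u : Uᵐᵒᵖ) (y : Y), u • y = y → u = 1)
    {S : ℓ²(Fin d × Y, ℂ) →L[ℂ] ℓ²(Fin d × Y, ℂ)} (hS : IsEquivariant U S) :
    vnDim U S.ker = vnDim U S.adjoint.ker := by
  -- Scaling makes `S` a contraction without changing kernels; the added 1 covers $S=0$.
  set c : ℂ := ((‖S‖ + 1 : ℝ) : ℂ)⁻¹ with hc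
  have hpos : 0 < ‖S‖ + 1 := by positivity
  have hc0 : c ≠ 0 := inv_ne_zero (Complex.ofReal_ne_zero.2 hpos.ne')
  have h := vnDim_ker_adjoint_of_norm_le_one free (hS.smul c) (by
    rw [norm_smul, hc, norm_inv, Complex.norm_real, Real.norm_of_nonneg hpos.le,
      inv_mul_le_iff₀ hpos]
    linarith)
  rw [vnDim_congr (ker_smul_eq S hc0)] at h
  rw [h]
  refine vnDim_congr ?_
  rw [map_smulₛₗ]
  exact ker_smul_eq S.adjoint (by simpa using hc0)

/-- `localDim` as a sum of squared norms. -/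
theorem localDim_eq_sum_norm_sq {Y : Type*} {d : ℕ} (V : Submodule ℂ ℓ²(Fin d × Y, ℂ))
    [V.HasOrthogonalProjection] (y : Y) :
    localDim V y = ∑ j, ‖V.starProjection (delta (j, y))‖ ^ 2 := by
  classical
  refine Finset.sum_congr rfl fun j _ => ?_
  have h := Submodule.re_inner_starProjection_eq_normSq V (delta (j, y))
  rw [Submodule.coe_norm, ← Submodule.starProjection_apply] at h
  rw [← h, delta_eq_single]
  congr!

theorem localDim_nonneg {Y : Type*} {d : ℕ} (V : Submodule ℂ ℓ²(Fin d × Y, ℂ))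
    [V.HasOrthogonalProjection] (y : Y) : 0 ≤ localDim V y := by
  rw [localDim_eq_sum_norm_sq]
  positivity

end Dim

/-! ### Extension by zero and cut-off -/

section Pullback

variable {α β : Type*} (φ : α → β) (hφ : Function.Injective φ)

theorem pullback_delta (a : α) : pullback φ hφ (delta (φ a)) = delta a := by
  classical
  ext b
  simp [delta_apply, hφ.eq_iff]

@[simp] theorem adjoint_pullback_apply (f : ℓ²(α, ℂ)) (a : α) :
    (pullback φ hφ).adjoint f (φ a) = f a := by
  rw [← inner_delta_left, ContinuousLinearMap.adjoint_inner_right, pullback_delta,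
    inner_delta_left]

theorem adjoint_pullback_apply_of_notMem (f : ℓ²(α, ℂ)) {b : β} (hb : b ∉ Set.range φ) :
    (pullback φ hφ).adjoint f b = 0 := by
  classical
  have h : pullback φ hφ (delta b) = 0 := by
    ext a
    have : φ a ≠ b := fun h => hb ⟨a, h⟩
    simp [delta_apply, this]
  rw [← inner_delta_left, ContinuousLinearMap.adjoint_inner_right, h, inner_zero_left]

theorem pullback_adjoint_pullback (f : ℓ²(α, ℂ)) :
    pullback φ hφ ((pullback φ hφ).adjoint f) = f := by
  ext a
  simp

theorem norm_adjoint_pullback (f : ℓ²(α, ℂ)) : ‖(pullback φ hφ).adjoint f‖ = ‖f‖ := by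
  rw [← sq_eq_sq₀ (norm_nonneg _) (norm_nonneg _), ← @inner_self_eq_norm_sq ℂ,
    ← @inner_self_eq_norm_sq ℂ, ContinuousLinearMap.adjoint_inner_left, pullback_adjoint_pullback]

end Pullback

/-- Multiplication by the indicator function of a set `A`. -/
def cutoff {Y : Type*} (d : ℕ) (A : Set Y) : ℓ²(Fin d × Y, ℂ) →L[ℂ] ℓ²(Fin d × Y, ℂ) :=
  (pullback (Subtype.val : {p : Fin d × Y // p.2 ∈ A} → _) Subtype.val_injective).adjoint ∘L
    pullback (Subtype.val : {p : Fin d × Y // p.2 ∈ A} → _) Subtype.val_injective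

section Cutoff

variable {Y : Type*} {d : ℕ} {A : Set Y}

theorem cutoff_apply_of_mem (f : ℓ²(Fin d × Y, ℂ)) (j : Fin d) {y : Y} (hy : y ∈ A) :
    cutoff d A f (j, y) = f (j, y) :=
  adjoint_pullback_apply (Subtype.val : {p : Fin d × Y // p.2 ∈ A} → _) Subtype.val_injective _
    ⟨(j, y), hy⟩

theorem cutoff_apply_of_notMem (f : ℓ²(Fin d × Y, ℂ)) (j : Fin d) {y : Y} (hy : y ∉ A) :
    cutoff d A f (j, y) = 0 := by
  refine adjoint_pullback_apply_of_notMem (Subtype.val : {p : Fin d × Y // p.2 ∈ A} → _)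
    Subtype.val_injective _ ?_
  rintro ⟨p, hp⟩
  exact hy (by simpa [hp] using p.2)

theorem adjoint_cutoff : (cutoff d A).adjoint = cutoff d A := by
  rw [cutoff, ContinuousLinearMap.adjoint_comp, ContinuousLinearMap.adjoint_adjoint]

theorem cutoff_delta_of_notMem (j : Fin d) {y : Y} (hy : y ∉ A) :
    cutoff d A (delta (j, y)) = 0 := by
  classical
  ext ⟨k, z⟩
  by_cases hz : z ∈ A
  · have : z ≠ y := fun h => hy (h ▸ hz)
    rw [cutoff_apply_of_mem _ _ hz]
    simp [delta_apply, this]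
  · rw [cutoff_apply_of_notMem _ _ hz]
    rfl

theorem cutoff_eq_zero_iff (f : ℓ²(Fin d × Y, ℂ)) :
    cutoff d A f = 0 ↔ ∀ j, ∀ y ∈ A, f (j, y) = 0 := by
  refine ⟨fun h j y hy => ?_, fun h => ?_⟩
  · rw [← cutoff_apply_of_mem f j hy, h]
    rfl
  · ext ⟨j, y⟩
    by_cases hy : y ∈ A
    · rw [cutoff_apply_of_mem _ _ hy, h j y hy]
      rfl
    · rw [cutoff_apply_of_notMem _ _ hy]
      rfl

theorem isEquivariant_cutoff {U : Type*} [Group U] [MulAction Uᵐᵒᵖ Y]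
    (hA : ∀ (u : Uᵐᵒᵖ) (y : Y), u • y ∈ A ↔ y ∈ A) : IsEquivariant U (cutoff d A) := by
  intro u f
  ext ⟨j, y⟩
  rw [rightTranslate_apply]
  by_cases hy : y ∈ A
  · rw [cutoff_apply_of_mem _ _ hy, cutoff_apply_of_mem _ _ ((hA u y).2 hy), rightTranslate_apply]
  · rw [cutoff_apply_of_notMem _ _ hy, cutoff_apply_of_notMem _ _ (mt (hA u y).1 hy)]

end Cutoff

/-! ### Comparison of dimensions -/

theorem norm_delta {α : Type*} (a : α) : ‖delta a‖ = 1 := by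
  classical
  rw [delta_eq_single, lp.norm_single (by norm_num)]
  simp

section LocalDim

variable {X Y : Type*} {d : ℕ}

theorem localDim_of_delta_mem (V : Submodule ℂ ℓ²(Fin d × Y, ℂ)) [V.HasOrthogonalProjection]
    {y : Y} (h : ∀ j, delta (j, y) ∈ V) : localDim V y = d := by
  rw [localDim_eq_sum_norm_sq]
  simp [Submodule.starProjection_eq_self_iff.2 (h _), norm_delta]

theorem localTrace_one (y : Y) :
    localTrace (1 : ℓ²(Fin d × Y, ℂ) →L[ℂ] ℓ²(Fin d × Y, ℂ)) y = d := by
  classical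
  simp [localTrace, delta_apply]

theorem localDim_orthogonal (V : Submodule ℂ ℓ²(Fin d × Y, ℂ)) [V.HasOrthogonalProjection]
    (y : Y) : localDim Vᗮ y = d - localDim V y := by
  rw [localDim_eq_re_localTrace, localDim_eq_re_localTrace, Submodule.starProjection_orthogonal']
  have := congrArg Complex.re (localTrace_one (d := d) y)
  simp only [localTrace, Complex.re_sum, _root_.sub_apply, lp.coeFn_sub, Pi.sub_apply,
    Complex.sub_re, Finset.sum_sub_distrib, Complex.natCast_re] at this ⊢
  rw [this]

/-- Monotonicity of `localDim` under extension by zero. -/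
theorem localDim_le_of_adjoint_pullback_mem {φ : Y → X} (hφ : Function.Injective φ)
    (V : Submodule ℂ ℓ²(Fin d × Y, ℂ)) [V.HasOrthogonalProjection]
    (W : Submodule ℂ ℓ²(Fin d × X, ℂ)) [W.HasOrthogonalProjection]
    (h : ∀ f ∈ V, (pullback (Prod.map id φ) (Function.injective_id.prodMap hφ)).adjoint f ∈ W)
    (y : Y) : localDim V y ≤ localDim W (φ y) := by
  rw [localDim_eq_sum_norm_sq, localDim_eq_sum_norm_sq]
  refine Finset.sum_le_sum fun j _ => ?_
  set Q := pullback (Prod.map (id : Fin d → Fin d) φ) (Function.injective_id.prodMap hφ)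
  set v := V.starProjection (delta (j, y)) with hv
  have hvV : v ∈ V := V.starProjection_apply_mem _
  -- Since $Q^*v\in W$, one has $\|v\|^2=\langle v,\delta\rangle=\langle
  -- Q^*v,\mathrm{pr}_W\delta\rangle$; Cauchy–Schwarz and the isometry $Q^*$ then bound $\|v\|$.
  have e1 : inner ℂ v (delta (j, y)) = inner ℂ v v := by
    nth_rewrite 2 [hv]
    rw [← Submodule.inner_starProjection_left_eq_right, Submodule.starProjection_eq_self_iff.2 hvV]
  have e2 : inner ℂ v (delta (j, y)) =
      inner ℂ (Q.adjoint v) (W.starProjection (delta (j, φ y))) := by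
    rw [← Submodule.inner_starProjection_left_eq_right,
      Submodule.starProjection_eq_self_iff.2 (h v hvV), ContinuousLinearMap.adjoint_inner_left]
    exact congrArg (inner ℂ v) (pullback_delta _ (Function.injective_id.prodMap hφ) (j, y)).symm
  have h3 : ‖v‖ ^ 2 ≤ ‖v‖ * ‖W.starProjection (delta (j, φ y))‖ := by
    have h4 := norm_inner_le_norm (𝕜 := ℂ) (Q.adjoint v) (W.starProjection (delta (j, φ y)))
    rw [← e2, e1, norm_adjoint_pullback, inner_self_eq_norm_sq_to_K] at h4
    simpa using h4
  gcongr
  by_contra! hlt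
  have h5 : 0 < ‖v‖ := (norm_nonneg _).trans_lt hlt
  nlinarith

/-- Dual to extension by zero: if restriction maps `W` into `V`, its adjoint maps $V^\perp$ into
$W^\perp$. -/
theorem localDim_le_of_pullback_mem {φ : Y → X} (hφ : Function.Injective φ)
    (V : Submodule ℂ ℓ²(Fin d × Y, ℂ)) [V.HasOrthogonalProjection]
    (W : Submodule ℂ ℓ²(Fin d × X, ℂ)) [W.HasOrthogonalProjection]
    (h : ∀ f ∈ W, pullback (Prod.map id φ) (Function.injective_id.prodMap hφ) f ∈ V)
    (y : Y) : localDim W (φ y) ≤ localDim V y := by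
  have h1 := localDim_le_of_adjoint_pullback_mem hφ Vᗮ Wᗮ (fun f hf w hw => by
    rw [ContinuousLinearMap.adjoint_inner_right]
    exact hf _ (h w hw)) y
  rw [localDim_orthogonal, localDim_orthogonal] at h1
  linarith

end LocalDim

/-! ### The dimension cost of conditions on an invariant set -/

section VnDim

variable {U Y : Type*} [Group U] [MulAction Uᵐᵒᵖ Y] {d : ℕ} [Finite (Orbits U Y)]

/-- Imposing the vanishing of `T f` on an invariant set `A` lowers the dimension of a closed
invariant subspace by at most `d |A / U|`. -/
theorem vnDim_le_vnDim_add (free : ∀ (u : Uᵐᵒᵖ) (y : Y), u • y = y → u = 1) {A : Set Y}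
    (hA : ∀ (u : Uᵐᵒᵖ) (y : Y), u • y ∈ A ↔ y ∈ A)
    {T : ℓ²(Fin d × Y, ℂ) →L[ℂ] ℓ²(Fin d × Y, ℂ)} (hT : IsEquivariant U T)
    (K L : Submodule ℂ ℓ²(Fin d × Y, ℂ)) [K.HasOrthogonalProjection] [L.HasOrthogonalProjection]
    (hK : ∀ (u : Uᵐᵒᵖ), ∀ f ∈ K, rightTranslate Y d u f ∈ K)
    (hL : ∀ f, f ∈ L ↔ f ∈ K ∧ cutoff d A (T f) = 0) :
    vnDim U K ≤ vnDim U L + d * {ω : Orbits U Y | Quotient.out ω ∈ A}.ncard := by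
  classical
  have := Fintype.ofFinite (Orbits U Y)
  -- Here $\ker S=K^\perp\oplus L$, while $\ker S^*$ contains every function supported off $A$.
  -- Equality of the two kernel dimensions gives the bound.
  set S := cutoff d A * T * K.starProjection with hS
  have hSapp : ∀ f, S f = cutoff d A (T (K.starProjection f)) := fun _ => rfl
  have hSeq : IsEquivariant U S :=
    ((isEquivariant_cutoff hA).mul hT).mul (IsEquivariant.starProjection hK)
  have hLK : ∀ f, L.starProjection f ∈ K ∧ cutoff d A (T (L.starProjection f)) = 0 :=
    fun f => (hL _).1 (L.starProjection_apply_mem f)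
  have hpr : ∀ f, S.ker.starProjection f = f - K.starProjection f + L.starProjection f := by
    intro f
    refine Submodule.eq_starProjection_of_mem_of_inner_eq_zero ?_ fun w hw => ?_
    · change S _ = 0
      rw [hSapp, map_add, map_sub,
        Submodule.starProjection_eq_self_iff.2 (K.starProjection_apply_mem f),
        Submodule.starProjection_eq_self_iff.2 (hLK f).1, sub_self, zero_add, (hLK f).2]
    · have hw' : K.starProjection w ∈ L := (hL _).2 ⟨K.starProjection_apply_mem w, hw⟩
      have e : f - (f - K.starProjection f + L.starProjection f)
          = K.starProjection (f - L.starProjection f) := by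
        rw [map_sub, Submodule.starProjection_eq_self_iff.2 (hLK f).1]
        abel
      rw [e, Submodule.inner_starProjection_left_eq_right]
      exact L.starProjection_inner_eq_zero f _ hw'
  have hloc : ∀ y, localDim S.ker y = d - localDim K y + localDim L y := by
    intro y
    rw [← localDim_orthogonal]
    simp only [localDim_eq_re_localTrace, localTrace, ← Complex.add_re,
      ← Finset.sum_add_distrib, hpr, Submodule.starProjection_orthogonal_val]
    rfl
  have hadj : ∀ y, (d : ℝ) - (if y ∈ A then (d : ℝ) else 0) ≤ localDim S.adjoint.ker y := by
    intro y
    split_ifs with hy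
    · rw [sub_self]
      exact localDim_nonneg _ _
    · rw [sub_zero]
      refine (localDim_of_delta_mem _ fun j => ?_).ge
      change S.adjoint _ = 0
      refine ext_inner_right ℂ fun g => ?_
      rw [ContinuousLinearMap.adjoint_inner_left, hSapp, ← ContinuousLinearMap.adjoint_inner_left,
        adjoint_cutoff, cutoff_delta_of_notMem j hy, inner_zero_left, inner_zero_left]
  have hdim := vnDim_ker_adjoint free hSeq
  have hcard : ∑ ω : Orbits U Y, (if Quotient.out ω ∈ A then (d : ℝ) else 0) =
      d * {ω : Orbits U Y | Quotient.out ω ∈ A}.ncard := by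
    rw [← Finset.sum_filter, Finset.sum_const, nsmul_eq_mul, mul_comm, Set.ncard_eq_toFinset_card']
    congr 3
    ext
    simp
  simp only [vnDim, finsum_eq_sum_of_fintype] at hdim ⊢
  have hsum := Finset.sum_le_sum fun (ω : Orbits U Y) (_ : ω ∈ Finset.univ) =>
    hadj (Quotient.out ω)
  rw [← hdim, Finset.sum_sub_distrib, hcard] at hsum
  simp only [hloc, Finset.sum_add_distrib, Finset.sum_sub_distrib] at hsum
  linarith

end VnDim

/-! ### Operators given by matrices over the group ring -/

section MatrixOp

variable {G X : Type*} [Group G] [MulAction G X] {d : ℕ}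
  (B : Matrix (Fin d) (Fin d) (MonoidAlgebra ℂ G))

/-- Locality: a value depends on finitely many translates of the point. Allowing two $G$-sets lets
`G` be compared with an orbit in `X`. -/
theorem matrixOp_apply_congr {X' : Type*} [MulAction G X'] {f : ℓ²(Fin d × X, ℂ)}
    {f' : ℓ²(Fin d × X', ℂ)} {x : X} {x' : X'} (k : Fin d)
    (h : ∀ l, ∀ g ∈ (B k l).coeff.support, f (l, g⁻¹ • x) = f' (l, g⁻¹ • x')) :
    matrixOp X B f (k, x) = matrixOp X' B f' (k, x') := by
  rw [matrixOp_apply, matrixOp_apply]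
  refine Finset.sum_congr rfl fun l _ => Finset.sum_congr rfl fun g hg => ?_
  exact congrArg _ (h l g hg)

theorem matrixOp_apply_eq_zero {f : ℓ²(Fin d × X, ℂ)} {x : X} (k : Fin d)
    (h : ∀ l, ∀ g ∈ (B k l).coeff.support, f (l, g⁻¹ • x) = 0) :
    matrixOp X B f (k, x) = 0 := by
  rw [matrixOp_apply_congr (X' := X) B (f' := 0) (x' := x) k h, map_zero]
  rfl

/-- By freeness, $g\mapsto gx$ embeds `G` equivariantly in `X`. Restriction to the orbit and
extension by zero from it both preserve kernels, giving the two inequalities. -/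
theorem localDim_ker_matrixOp (free : ∀ (g : G) (x : X), g • x = x → g = 1) (x : X) :
    localDim (matrixOp X B).ker x = groupDim (matrixOp G B).ker := by
  have hφ : Function.Injective fun g : G => g • x := by
    intro g h hgh
    have : (h⁻¹ * g) • x = x := by
      rw [mul_smul, inv_smul_eq_iff]
      exact hgh
    exact (inv_mul_eq_one.1 (free _ _ this)).symm
  have hφ' := (Function.injective_id (α := Fin d)).prodMap hφ
  have key : ∀ y : G, localDim (matrixOp X B).ker (y • x) = localDim (matrixOp G B).ker y := by
    intro y
    refine le_antisymm (localDim_le_of_pullback_mem hφ _ _ (fun f hf => ?_) y)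
      (localDim_le_of_adjoint_pullback_mem hφ _ _ (fun f hf => ?_) y)
    · change matrixOp G B _ = 0
      replace hf : matrixOp X B f = 0 := hf
      ext ⟨k, g⟩
      rw [matrixOp_apply_congr (X' := X) B (f' := f) (x' := g • x) k, hf]
      · rfl
      · intro l h _
        simp [mul_smul]
    · change matrixOp X B _ = 0
      replace hf : matrixOp G B f = 0 := hf
      ext ⟨k, z⟩
      by_cases hz : ∃ g : G, g • x = z
      · obtain ⟨g, rfl⟩ := hz
        rw [matrixOp_apply_congr (X' := G) B (f' := f) (x' := g) k, hf]
        · rfl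
        · intro l h _
          rw [← mul_smul]
          exact adjoint_pullback_apply _ hφ' f (l, h⁻¹ * g)
      · refine matrixOp_apply_eq_zero B k fun l h _ => ?_
        refine adjoint_pullback_apply_of_notMem _ hφ' f ?_
        rintro ⟨⟨l', g⟩, hg⟩
        rw [Prod.map_apply, Prod.mk.injEq] at hg
        exact hz ⟨h * g, by rw [mul_smul, hg.2, smul_inv_smul]⟩
  simpa [groupDim] using key 1

end MatrixOp

/-! ### Kernels of compressions against the kernel of the full operator -/

section Compression

variable {G U X : Type*} [Group G] [Group U] [MulAction G X] [MulAction Uᵐᵒᵖ X] {d : ℕ}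
  (B : Matrix (Fin d) (Fin d) (MonoidAlgebra ℂ G)) (Y : SubMulAction Uᵐᵒᵖ X)

theorem adjoint_restrict_apply_of_mem (f : ℓ²(Fin d × Y, ℂ)) (j : Fin d) {x : X} (hx : x ∈ Y) :
    (restrict d Y).adjoint f (j, x) = f (j, ⟨x, hx⟩) :=
  adjoint_pullback_apply _ _ f (j, (⟨x, hx⟩ : Y))

theorem adjoint_restrict_apply_of_notMem (f : ℓ²(Fin d × Y, ℂ)) (j : Fin d) {x : X}
    (hx : x ∉ Y) : (restrict d Y).adjoint f (j, x) = 0 := by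
  refine adjoint_pullback_apply_of_notMem _ _ f ?_
  rintro ⟨⟨l, y⟩, h⟩
  rw [Prod.map_apply, Prod.mk.injEq] at h
  exact hx (h.2 ▸ y.2)

theorem compression_apply (f : ℓ²(Fin d × Y, ℂ)) (j : Fin d) (y : Y) :
    compression B Y f (j, y) = matrixOp X B ((restrict d Y).adjoint f) (j, (y : X)) := rfl

theorem isEquivariant_compression (comm : ∀ (g : G) (u : Uᵐᵒᵖ) (x : X), g • u • x = u • g • x) :
    IsEquivariant U (compression B Y) := by
  intro u f
  ext ⟨k, y⟩
  rw [rightTranslate_apply, compression_apply, compression_apply]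
  refine matrixOp_apply_congr B k fun l g _ => ?_
  rw [SubMulAction.val_smul, comm]
  by_cases hy : g⁻¹ • (y : X) ∈ Y
  · rw [adjoint_restrict_apply_of_mem _ _ _ hy, rightTranslate_apply,
      adjoint_restrict_apply_of_mem _ _ _ (Y.smul_mem u hy)]
    rfl
  · rw [adjoint_restrict_apply_of_notMem _ _ _ hy, adjoint_restrict_apply_of_notMem]
    rwa [SubMulAction.smul_mem_iff']

/-- The points of `Y` that some element of `F` moves out of `Y`. -/
def boundary (F : Finset G) : Set Y := {y | ∃ g ∈ F, g • (y : X) ∉ Y}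

theorem smul_mem_boundary (comm : ∀ (g : G) (u : Uᵐᵒᵖ) (x : X), g • u • x = u • g • x)
    (F : Finset G) (u : Uᵐᵒᵖ) (y : Y) : u • y ∈ boundary Y F ↔ y ∈ boundary Y F := by
  simp only [boundary, Set.mem_ofPred_eq, SubMulAction.val_smul, comm, SubMulAction.smul_mem_iff']

open Classical in
/-- The group elements in the supports of the entries of `B`, and their inverses. -/
def matrixSupport : Finset G :=
  Finset.univ.biUnion fun k => Finset.univ.biUnion fun l =>
    (B k l).coeff.support ∪ (B k l).coeff.support⁻¹

variable {B} in
theorem mem_matrixSupport {k l : Fin d} {g : G} (hg : g ∈ (B k l).coeff.support) :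
    g ∈ matrixSupport B ∧ g⁻¹ ∈ matrixSupport B := by
  classical
  simp only [matrixSupport, Finset.mem_biUnion, Finset.mem_univ, true_and, Finset.mem_union]
  exact ⟨⟨k, l, .inl hg⟩, ⟨k, l, .inr (Finset.inv_mem_inv hg)⟩⟩

variable [Finite (Orbits U Y)]

theorem vnDim_le_of_localDim_le (V : Submodule ℂ ℓ²(Fin d × Y, ℂ)) [V.HasOrthogonalProjection]
    {c : ℝ} (h : ∀ y, localDim V y ≤ c) : vnDim U V ≤ Nat.card (Orbits U Y) * c := by
  have := Fintype.ofFinite (Orbits U Y)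
  rw [vnDim, finsum_eq_sum_of_fintype, Nat.card_eq_fintype_card, ← nsmul_eq_mul]
  exact Finset.sum_le_card_nsmul _ _ _ fun ω _ => h _

theorem le_vnDim_of_le_localDim (V : Submodule ℂ ℓ²(Fin d × Y, ℂ)) [V.HasOrthogonalProjection]
    {c : ℝ} (h : ∀ y, c ≤ localDim V y) : Nat.card (Orbits U Y) * c ≤ vnDim U V := by
  have := Fintype.ofFinite (Orbits U Y)
  rw [vnDim, finsum_eq_sum_of_fintype, Nat.card_eq_fintype_card, ← nsmul_eq_mul]
  exact Finset.card_nsmul_le_sum _ _ _ fun ω _ => h _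

theorem vnDim_ker_compression_le
    (comm : ∀ (g : G) (u : Uᵐᵒᵖ) (x : X), g • u • x = u • g • x)
    (free_left : ∀ (g : G) (x : X), g • x = x → g = 1)
    (free_right : ∀ (u : Uᵐᵒᵖ) (y : Y), u • y = y → u = 1) :
    vnDim U (compression B Y).ker ≤
      Nat.card (Orbits U Y) * groupDim (matrixOp G B).ker +
        d * {ω : Orbits U Y | Quotient.out ω ∈ boundary Y (matrixSupport B)}.ncard := by
  set A := boundary Y (matrixSupport B)
  have hB := isEquivariant_compression B Y comm
  -- Vectors of `L` extend by zero into $\ker B_X$, which bounds the local dimension of `L`;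
  -- vanishing on `A` is the condition whose cost is counted.
  let L := (compression B Y).ker ⊓ (cutoff d A).ker
  have hLc : IsClosed (L : Set ℓ²(Fin d × Y, ℂ)) :=
    (compression B Y).isClosed_ker.inter (cutoff d A).isClosed_ker
  have : CompleteSpace L := hLc.completeSpace_coe
  refine (vnDim_le_vnDim_add free_right (smul_mem_boundary Y comm _) IsEquivariant.one _ L
    hB.mem_ker fun f => Iff.rfl).trans ?_
  gcongr
  refine vnDim_le_of_localDim_le Y L fun y => ?_
  rw [← localDim_ker_matrixOp B free_left (y : X)]
  refine localDim_le_of_adjoint_pullback_mem Subtype.val_injective _ _ (fun f hf => ?_) y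
  have h1 : compression B Y f = 0 := hf.1
  have h2 := (cutoff_eq_zero_iff f).1 hf.2
  change matrixOp X B ((restrict d Y).adjoint f) = 0
  ext ⟨k, x⟩
  by_cases hx : x ∈ Y
  · rw [← compression_apply B Y f k ⟨x, hx⟩, h1]
    rfl
  · refine matrixOp_apply_eq_zero B k fun l g hg => ?_
    by_cases hg' : g⁻¹ • x ∈ Y
    -- The point $g^{-1}x$ lies in `Y` and `g` moves it to $x\notin Y$, so it is a boundary point,
    -- where `f` vanishes.
    · rw [adjoint_restrict_apply_of_mem _ _ _ hg']
      refine h2 l _ ⟨g, (mem_matrixSupport hg).1, ?_⟩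
      rwa [smul_inv_smul]
    · exact adjoint_restrict_apply_of_notMem _ _ _ hg'

theorem le_vnDim_ker_compression
    (comm : ∀ (g : G) (u : Uᵐᵒᵖ) (x : X), g • u • x = u • g • x)
    (free_left : ∀ (g : G) (x : X), g • x = x → g = 1)
    (free_right : ∀ (u : Uᵐᵒᵖ) (y : Y), u • y = y → u = 1) :
    Nat.card (Orbits U Y) * groupDim (matrixOp G B).ker ≤
      vnDim U (compression B Y).ker +
        d * {ω : Orbits U Y | Quotient.out ω ∈ boundary Y (matrixSupport B)}.ncard := by
  set A := boundary Y (matrixSupport B)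
  have hB := isEquivariant_compression B Y comm
  have hinv := smul_mem_boundary Y comm (matrixSupport B)
  have hC : IsEquivariant U (cutoff d Aᶜ * compression B Y) :=
    (isEquivariant_cutoff fun u y => not_congr (hinv u y)).mul hB
  -- The larger space only requires $B[i]f=0$ off `A`, so it contains the restrictions of $\ker
  -- B_X$. Requiring $B[i]f=0$ on `A` too cuts out $\ker B[i]$.
  refine le_trans ?_ (vnDim_le_vnDim_add free_right hinv hB (cutoff d Aᶜ * compression B Y).ker _
    hC.mem_ker fun f => ?_)
  · refine le_vnDim_of_le_localDim Y _ fun y => ?_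
    rw [← localDim_ker_matrixOp B free_left (y : X)]
    refine localDim_le_of_pullback_mem Subtype.val_injective _ _ (fun f hf => ?_) y
    replace hf : matrixOp X B f = 0 := hf
    change cutoff d Aᶜ (compression B Y (restrict d Y f)) = 0
    refine (cutoff_eq_zero_iff _).2 fun j z hz => ?_
    have h0 : matrixOp X B f (j, (z : X)) = 0 := by
      rw [hf]
      rfl
    rw [compression_apply, ← h0]
    refine matrixOp_apply_congr B j fun l g hg => ?_
    -- This is where inverses of support elements must enter the boundary.
    have hz' : g⁻¹ • (z : X) ∈ Y := by
      by_contra hg'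
      exact hz ⟨g⁻¹, (mem_matrixSupport hg).2, hg'⟩
    rw [adjoint_restrict_apply_of_mem _ _ _ hz']
    rfl
  · change compression B Y f = 0 ↔ cutoff d Aᶜ (compression B Y f) = 0 ∧ _
    refine ⟨fun h => by simp [h], fun ⟨h1, h2⟩ => ?_⟩
    rw [cutoff_eq_zero_iff] at h1 h2
    ext ⟨j, y⟩
    by_cases hy : y ∈ A
    · exact h2 j y hy
    · exact h1 j y hy

end Compression

/-! ### The Følner condition -/

section Folner

variable {G U X : Type*} [Group G] [Group U] [MulAction G X] [MulAction Uᵐᵒᵖ X]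

theorem orbit_smul_mk_eq (comm : ∀ (g : G) (u : Uᵐᵒᵖ) (x : X), g • u • x = u • g • x) (g : G)
    {x y : X} (h : (Quotient.mk _ x : Orbits U X) = Quotient.mk _ y) :
    (Quotient.mk _ (g • x) : Orbits U X) = Quotient.mk _ (g • y) := by
  obtain ⟨u, rfl⟩ := MulAction.orbitRel_apply.1 (Quotient.exact h)
  exact Quotient.sound (MulAction.orbitRel_apply.2 ⟨u, (comm g u y).symm⟩)

/-- The set of orbits that meet `A`. -/
abbrev orbitSet (U : Type*) {X : Type*} [Group U] [MulAction Uᵐᵒᵖ X] (A : Set X) :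
    Set (Orbits U X) :=
  (Quotient.mk _ : X → Orbits U X) '' A

theorem orbitSet_smul_subset (comm : ∀ (g : G) (u : Uᵐᵒᵖ) (x : X), g • u • x = u • g • x)
    (g : G) (A : Set X) :
    orbitSet U (g • A) ⊆
      Quotient.map' (g • ·) (fun _ _ h => Quotient.exact (orbit_smul_mk_eq comm g
        (Quotient.sound h))) '' orbitSet U A := by
  rintro _ ⟨_, ⟨x, hx, rfl⟩, rfl⟩
  exact ⟨_, ⟨x, hx, rfl⟩, rfl⟩

theorem orbitSet_smul_finite (comm : ∀ (g : G) (u : Uᵐᵒᵖ) (x : X), g • u • x = u • g • x)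
    (g : G) {A : Set X} (hA : (orbitSet U A).Finite) : (orbitSet U (g • A)).Finite :=
  (hA.image _).subset (orbitSet_smul_subset comm g A)

theorem orbitCount_smul_le (comm : ∀ (g : G) (u : Uᵐᵒᵖ) (x : X), g • u • x = u • g • x)
    (g : G) {A : Set X} (hA : (orbitSet U A).Finite) :
    orbitCount U (g • A) ≤ orbitCount U A :=
  (Set.ncard_le_ncard (orbitSet_smul_subset comm g A) (hA.image _)).trans
    (Set.ncard_image_le hA)

theorem orbitCount_union_le (A A' : Set X) :
    orbitCount U (A ∪ A') ≤ orbitCount U A + orbitCount U A' := by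
  rw [orbitCount, Set.image_union]
  exact Set.ncard_union_le _ _

theorem orbitSet_finite (Y : SubMulAction Uᵐᵒᵖ X) [Finite (Orbits U Y)] :
    (orbitSet U (Y : Set X)).Finite := by
  refine (Set.finite_range fun ω : Orbits U Y =>
    (Quotient.mk _ ((Quotient.out ω : Y) : X) : Orbits U X)).subset ?_
  rintro _ ⟨x, hx, rfl⟩
  refine ⟨Quotient.mk _ ⟨x, hx⟩, Quotient.sound (MulAction.orbitRel_apply.2 ?_)⟩
  obtain ⟨u, hu⟩ := MulAction.orbitRel_apply.1
    (Quotient.mk_out (s := MulAction.orbitRel Uᵐᵒᵖ Y) ⟨x, hx⟩)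
  exact ⟨u, congrArg Subtype.val hu⟩

/-- The points of `Y` that `g` moves out of `Y`. -/
def exitSet (Y : SubMulAction Uᵐᵒᵖ X) (g : G) : Set X := {x | x ∈ Y ∧ g • x ∉ Y}

theorem exitSet_mul_subset (Y : SubMulAction Uᵐᵒᵖ X) (g h : G) :
    exitSet Y (g * h) ⊆ exitSet Y h ∪ h⁻¹ • exitSet Y g := by
  rintro x ⟨hx, hgx⟩
  by_cases hh : h • x ∈ Y
  · right
    rw [Set.mem_smul_set_iff_inv_smul_mem, inv_inv]
    exact ⟨hh, by rwa [← mul_smul]⟩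
  · exact .inl ⟨hx, hh⟩

/-- Induction on word length in `S`: a point leaving under $sh$ either leaves under $h$, or is
carried by $h$ to a point leaving under $s$. `C` bounds the word length, uniformly in `i`. -/
theorem orbitCount_exitSet_le {S : Finset G} {E : ℕ → SubMulAction Uᵐᵒᵖ X}
    (hE : IsFolnerExhaustion G U S E) (g : G) :
    ∃ C : ℕ, ∀ i, orbitCount U (exitSet (E i) g) ≤
      C * orbitCount U (((S : Set G) • (E i : Set X)) \ (E i : Set X)) := by
  -- `Set.ncard` is 0 on infinite sets, so comparing counts requires finiteness.
  have hfinE : ∀ i, (orbitSet U (E i : Set X)).Finite := fun i => by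
    have := hE.finite_orbits i
    exact orbitSet_finite (E i)
  have hfin : ∀ i, ∀ g : G, (orbitSet U (exitSet (E i) g)).Finite := fun i g =>
    (hfinE i).subset (Set.image_mono fun x hx => hx.1)
  have hfinS : ∀ i, (orbitSet U (((S : Set G) • (E i : Set X)) \ (E i : Set X))).Finite := by
    intro i
    refine ((S.finite_toSet).biUnion fun s _ =>
      orbitSet_smul_finite hE.comm s (hfinE i)).subset ?_
    rintro _ ⟨_, ⟨⟨s, hs, x, hx, rfl⟩, -⟩, rfl⟩
    exact Set.mem_biUnion hs ⟨s • x, ⟨x, hx, rfl⟩, rfl⟩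
  have hgen : ∀ s ∈ S, ∀ i, orbitCount U (exitSet (E i) s) ≤
      orbitCount U (((S : Set G) • (E i : Set X)) \ (E i : Set X)) := by
    intro s hs i
    refine le_trans (Set.ncard_le_ncard (Set.image_mono ?_)
      (orbitSet_smul_finite hE.comm s⁻¹ (hfinS i))) (orbitCount_smul_le hE.comm s⁻¹ (hfinS i))
    rintro x ⟨hx, hsx⟩
    rw [Set.mem_smul_set_iff_inv_smul_mem, inv_inv]
    exact ⟨Set.smul_mem_smul hs hx, hsx⟩
  have hmul : ∀ s ∈ S, ∀ h : G, (∃ C : ℕ, ∀ i, orbitCount U (exitSet (E i) h) ≤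
      C * orbitCount U (((S : Set G) • (E i : Set X)) \ (E i : Set X))) →
      ∃ C : ℕ, ∀ i, orbitCount U (exitSet (E i) (s * h)) ≤
        C * orbitCount U (((S : Set G) • (E i : Set X)) \ (E i : Set X)) := by
    rintro s hs h ⟨C, hC⟩
    refine ⟨C + 1, fun i => ?_⟩
    have h1 : orbitCount U (exitSet (E i) (s * h)) ≤
        orbitCount U (exitSet (E i) h ∪ h⁻¹ • exitSet (E i) s) := by
      refine Set.ncard_le_ncard (Set.image_mono (exitSet_mul_subset (E i) s h)) ?_
      rw [Set.image_union]
      exact (hfin i h).union (orbitSet_smul_finite hE.comm _ (hfin i s))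
    rw [add_mul, one_mul]
    exact h1.trans ((orbitCount_union_le _ _).trans (add_le_add (hC i)
      ((orbitCount_smul_le hE.comm _ (hfin i s)).trans (hgen s hs i))))
  have hg : g ∈ Subgroup.closure (S : Set G) := hE.generates ▸ Subgroup.mem_top g
  induction hg using Subgroup.closure_induction_left with
  | one =>
    refine ⟨0, fun i => ?_⟩
    have : exitSet (E i) (1 : G) = ∅ := by
      ext x
      simp [exitSet]
    simp [this, orbitCount]
  | mul_left s hs h _ ih => exact hmul s hs h ih
  | inv_mul_cancel s hs h _ ih => exact hmul s⁻¹ (hE.symm s hs) h ih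

theorem ncard_boundary_le (Y : SubMulAction Uᵐᵒᵖ X) [Finite (Orbits U Y)] (F : Finset G) :
    {ω : Orbits U Y | Quotient.out ω ∈ boundary Y F}.ncard ≤
      ∑ g ∈ F, orbitCount U (exitSet Y g) := by
  classical
  -- Orbits of `Y` inject into those of `X`, so boundary orbits can be counted in `X`.
  have hinj : Function.Injective fun ω : Orbits U Y =>
      (Quotient.mk _ ((Quotient.out ω : Y) : X) : Orbits U X) := by
    intro ω ω' h
    obtain ⟨u, hu⟩ := MulAction.orbitRel_apply.1 (Quotient.exact h)
    rw [← Quotient.out_eq ω, ← Quotient.out_eq ω']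
    exact Quotient.sound (MulAction.orbitRel_apply.2 ⟨u, Subtype.ext hu⟩)
  have hfin : ∀ g : G, (orbitSet U (exitSet Y g)).Finite := fun g =>
    (orbitSet_finite Y).subset (Set.image_mono fun x hx => hx.1)
  rw [← Set.ncard_image_of_injective _ hinj]
  refine (Set.ncard_le_ncard (t := ⋃ g ∈ F, orbitSet U (exitSet Y g)) ?_
    (F.finite_toSet.biUnion fun g _ => hfin g)).trans (F.set_ncard_biUnion_le _)
  rintro _ ⟨ω, ⟨g, hg, hω⟩, rfl⟩
  exact Set.mem_biUnion hg ⟨_, ⟨(Quotient.out ω : Y).2, hω⟩, rfl⟩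

theorem tendsto_ncard_boundary_div {S : Finset G} {E : ℕ → SubMulAction Uᵐᵒᵖ X}
    (hE : IsFolnerExhaustion G U S E) (F : Finset G) :
    Tendsto (fun i => ({ω : Orbits U (E i) | Quotient.out ω ∈ boundary (E i) F}.ncard : ℝ) /
      (Nat.card (Orbits U (E i)) : ℝ)) atTop (𝓝 0) := by
  choose C hC using orbitCount_exitSet_le hE
  have h := hE.folner.const_mul ((∑ g ∈ F, C g : ℕ) : ℝ)
  rw [mul_zero] at h
  refine squeeze_zero (fun i => by positivity) (fun i => ?_) h
  have := hE.finite_orbits i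
  rw [← mul_div_assoc]
  gcongr
  norm_cast
  rw [Finset.sum_mul]
  exact (ncard_boundary_le (E i) F).trans (Finset.sum_le_sum fun g _ => hC g i)

theorem eventually_card_orbits_pos [Nonempty X] {S : Finset G} {E : ℕ → SubMulAction Uᵐᵒᵖ X}
    (hE : IsFolnerExhaustion G U S E) : ∀ᶠ i in atTop, 0 < Nat.card (Orbits U (E i)) := by
  obtain ⟨k, hk⟩ := hE.exhausts (Classical.arbitrary X)
  filter_upwards [eventually_ge_atTop k] with i hi
  have := hE.finite_orbits i
  have : Nonempty (Orbits U (E i)) := ⟨Quotient.mk _ ⟨_, hE.mono hi hk⟩⟩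
  exact Nat.card_pos

end Folner

end L2Approx

end

theorem mainTheorem5 {G U X : Type*} [Group G] [Group U] [MulAction G X] [MulAction Uᵐᵒᵖ X]
    [Nonempty X] (S : Finset G) (E : ℕ → SubMulAction Uᵐᵒᵖ X)
    (hE : L2Approx.IsFolnerExhaustion G U S E) (d : ℕ)
    (B : Matrix (Fin d) (Fin d) (MonoidAlgebra ℂ G)) :
    Tendsto (fun i : ℕ =>
        haveI : Finite (L2Approx.Orbits U (E i)) := hE.finite_orbits i
        L2Approx.vnDim U (L2Approx.compression B (E i)).ker /
          (Nat.card (L2Approx.Orbits U (E i)) : ℝ))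
      atTop (𝓝 (L2Approx.groupDim (L2Approx.matrixOp G B).ker)) := by
  have hb := (L2Approx.tendsto_ncard_boundary_div hE (L2Approx.matrixSupport B)).const_mul (d : ℝ)
  rw [mul_zero] at hb
  have free_right : ∀ i, ∀ (u : Uᵐᵒᵖ) (y : E i), u • y = y → u = 1 := fun i u y h =>
    hE.free_right u y (congrArg Subtype.val h)
  rw [tendsto_iff_dist_tendsto_zero]
  refine squeeze_zero' (Eventually.of_forall fun i => dist_nonneg) ?_ hb
  -- Early sets may be empty; the division by $N_i$ needs $N_i>0$.
  filter_upwards [L2Approx.eventually_card_orbits_pos hE] with i hi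
  have := hE.finite_orbits i
  have h1 := L2Approx.vnDim_ker_compression_le B (E i) hE.comm hE.free_left (free_right i)
  have h2 := L2Approx.le_vnDim_ker_compression B (E i) hE.comm hE.free_left (free_right i)
  have hi' : (0 : ℝ) < Nat.card (L2Approx.Orbits U (E i)) := Nat.cast_pos.2 hi
  rw [Real.dist_eq, div_sub' hi'.ne', abs_div, abs_of_pos hi', ← mul_div_assoc]
  gcongr
  rw [abs_sub_le_iff]
  constructor <;> linarith
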